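/- Let $q\in\mathbb C$ with $|q|>1$, let $N\ge 1$ and $\alpha\ge 1$ be integers, and let $F$ be a $\mathbb C^N$-valued map that is analytic at $(0,0,0)\in\mathbb C\times\mathbb C\times\mathbb C^N$, with $F(0,0,0)=0$ and with invertible partial Jacobian matrix $D_yF(0,0,0)$. Consider the system $$\epsilon^\alpha\, d_{q,x}(y)(x,\epsilon)=F(x,\epsilon,y),\qquad d_{q,x}(y)(x,\epsilon)=\frac{y(qx,\epsilon)-y(x,\epsilon)}{qx-x},$$ where on formal power series $d_{q,x}$ acts term by term, $d_{q,x}(x^k\epsilon^n)=\frac{q^k-1}{q-1}x^{k-1}\epsilon^n$. Then this system has a unique formal power series solution $\hat y\in\mathbb C[[x,\epsilon]]^N$ with $\hat y(0,0)=0$. Write $\hat y=\sum_{n\ge 0}u_n(x)\epsilon^n$. There is $r>0$ such that, for every $n\ge 0$, the series $u_n$ converges on the closed disc $|x|\le r/|q|^{\lfloor n/\alpha\rfloor}$ and its sum is holomorphic and bounded on the open disc $|x|<r/|q|^{\lfloor n/\alpha\rfloor}$, and there are constants $C,A>0$ (which may depend on $q$, $\alpha$ and $F$) such that, for all $n\ge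 0$, $$\sup_{|x|\le r/|q|^{\lfloor n/\alpha\rfloor}}|u_n(x)|\le C A^n |q|^{n^2/(2\alpha^2)}.$$ -/

import Mathlib

open MvPowerSeries Metric

noncomputable section

namespace QDiff

/-- The `q`-number `[n]_q = (q ^ n - 1) / (q - 1)`, for `q ≠ 1`. -/
def qNumber (q : ℂ) (n : ℕ) : ℂ := (q ^ n - 1) / (q - 1)

/-- The ring `ℂ[[x, ε]]`: the variable with index `0` is `x`, the one with index `1` is `ε`. -/
abbrev FormalSeries : Type := MvPowerSeries (Fin 2) ℂ

/-- The exponent of the monomial `x ^ k * ε ^ n`. -/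
def expo (k n : ℕ) : Fin 2 →₀ ℕ := Finsupp.single 0 k + Finsupp.single 1 n

/-- Jackson's `q`-derivative with respect to `x`, acting term by term on `ℂ[[x, ε]]`:
`d_{q,x} (x ^ k * ε ^ n) = [k]_q * x ^ (k - 1) * ε ^ n`. -/
def qDeriv (q : ℂ) (f : FormalSeries) : FormalSeries :=
  fun m => qNumber q (m 0 + 1) * coeff (m + Finsupp.single 0 1) f

/-- The standard basis of `ℂ × ℂ × ℂ ^ N`, indexed by the variables: `inl 0` is `x`, `inl 1` is `ε`
and `inr j` is the `j`-th component of `y`. -/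
def basisVec {N : ℕ} : Fin 2 ⊕ Fin N → ℂ × ℂ × (Fin N → ℂ)
  | Sum.inl 0 => (1, 0, 0)
  | Sum.inl 1 => (0, 1, 0)
  | Sum.inr j => (0, 0, Pi.single j 1)

/-- The partial derivative at the origin of a map `F (x, ε, y)`, for the multi-index `m`: the
derivative of order `|m|`, evaluated on the list of basis vectors in which the vector of each
variable `s` occurs `m s` times (their order is irrelevant for analytic `F`, since the derivative
is symmetric). -/
def partialDeriv {N : ℕ} (F : ℂ × ℂ × (Fin N → ℂ) → Fin N → ℂ) (m : Fin 2 ⊕ Fin N →₀ ℕ) :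
    Fin N → ℂ :=
  iteratedFDeriv ℂ (Finsupp.toMultiset m).toList.length F 0
    (fun k => basisVec ((Finsupp.toMultiset m).toList.get k))

/-- The Taylor series at the origin of the `i`-th component of `F`: the coefficient with
multi-index `m` is `(∂ ^ m F_i)(0) / m!`. -/
def taylorSeries {N : ℕ} (F : ℂ × ℂ × (Fin N → ℂ) → Fin N → ℂ) (i : Fin N) :
    MvPowerSeries (Fin 2 ⊕ Fin N) ℂ :=
  fun m => partialDeriv F m i / ∏ s, ((m s).factorial : ℂ)

/-- The formal power series `F_i (x, ε, ŷ (x, ε))`, for `ŷ ∈ ℂ[[x, ε]] ^ N` without constant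
term. -/
def formalComp {N : ℕ} (F : ℂ × ℂ × (Fin N → ℂ) → Fin N → ℂ) (y : Fin N → FormalSeries)
    (i : Fin N) : FormalSeries :=
  subst (Sum.elim (fun s : Fin 2 => (X s : FormalSeries)) y) (taylorSeries F i)

/-- `ŷ ∈ ℂ[[x, ε]] ^ N` is a formal power series solution of `ε ^ α * d_{q,x} y = F (x, ε, y)`.
The condition `ŷ (0, 0) = 0` is what gives the formal series `F (x, ε, ŷ)` a meaning for a map `F`
that is only given near the origin. -/
def IsFormalSolution {N : ℕ} (q : ℂ) (α : ℕ) (F : ℂ × ℂ × (Fin N → ℂ) → Fin N → ℂ)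
    (y : Fin N → FormalSeries) : Prop :=
  (∀ i, constantCoeff (y i) = 0) ∧
    ∀ i, (X 1 : FormalSeries) ^ α * qDeriv q (y i) = formalComp F y i

/-- `f` is a bounded holomorphic map from `Ω ⊆ ℂ` to `ℂ ^ N`. -/
def BoundedHolomorphicOn {N : ℕ} (f : ℂ → Fin N → ℂ) (Ω : Set ℂ) : Prop :=
  DifferentiableOn ℂ f Ω ∧ ∃ M : ℝ, ∀ x ∈ Ω, ‖f x‖ ≤ M

/-- `f` is, on the set `K`, the sum of the coefficient `u_n (x) = ∑ a_{k,n} x ^ k` of `ε ^ n` in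
`ŷ = ∑ a_{k,n} x ^ k ε ^ n`. -/
def IsSumOfCoeff {N : ℕ} (y : Fin N → FormalSeries) (n : ℕ) (f : ℂ → Fin N → ℂ) (K : Set ℂ) :
    Prop :=
  ∀ x ∈ K, ∀ i, HasSum (fun k : ℕ => coeff (expo k n) (y i) * x ^ k) (f x i)

end QDiff

end

/-! Let `J` be the Jacobian in `y`, `B` its inverse, and `g` the Taylor series of `F` without its
linear part in `y`. The equation becomes the fixed-point problem `y = B (ε ^ α d_{q,x} y - g (x, ε,
y))`, whose right-hand side is `picard`.

Formal part: give `x` weight 1 and `ε` weight 2. Then `ε ^ α d_{q,x}` raises the order by `2 α - 1 ≥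
1`, and `g` has no linear term in `y`, so `picard` gains at least one order on differences
(`vanishesBelow_picard_sub`). Hence there is exactly one fixed point without constant term, the
limit of the iterates from 0.

Analytic part: the norm is a weighted `ℓ¹` norm that is submultiplicative and for which `ε ^ α
d_{q,x}` is bounded, although `[k]_q` grows like `|q| ^ k`. In `gevreyWeight` the radius in `x`
shrinks by `|q|` whenever `n` grows by `α`, and the triangular exponent pays for what remains
(`enorm_qNumber_succ_mul_gevreyWeight_le`). For small parameters `picard` maps a ball to itself
(`exists_forall_wnorm_iterate_picard_le`). No contraction in norm is needed: the iterates converge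
coefficientwise, so their limit inherits the bound. Restricting the norm to one power of `ε` gives
the convergence and the estimate of `u_n`. -/

noncomputable section

namespace QDiff

/-! ### The filtration by weighted order -/

/-- `f` has no monomial `x ^ k * ε ^ n` with `k + 2 * n < w`. -/
def VanishesBelow (w : ℕ) (f : FormalSeries) : Prop :=
  ∀ m : Fin 2 →₀ ℕ, m 0 + 2 * m 1 < w → coeff m f = 0

lemma VanishesBelow.mono {v w : ℕ} (h : v ≤ w) {f : FormalSeries} (hf : VanishesBelow w f) :
    VanishesBelow v f := fun m hm => hf m (by omega)

lemma vanishesBelow_zero_left (f : FormalSeries) : VanishesBelow 0 f := fun m hm => by omega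

lemma vanishesBelow_zero (w : ℕ) : VanishesBelow w 0 := fun m _ => by simp

lemma VanishesBelow.add {w : ℕ} {f g : FormalSeries} (hf : VanishesBelow w f)
    (hg : VanishesBelow w g) : VanishesBelow w (f + g) := fun m hm => by
  simp [hf m hm, hg m hm]

lemma VanishesBelow.sub {w : ℕ} {f g : FormalSeries} (hf : VanishesBelow w f)
    (hg : VanishesBelow w g) : VanishesBelow w (f - g) := fun m hm => by
  simp [hf m hm, hg m hm]

lemma VanishesBelow.smul {w : ℕ} {f : FormalSeries} (c : ℂ) (hf : VanishesBelow w f) :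
    VanishesBelow w (c • f) := fun m hm => by
  simp [hf m hm]

lemma VanishesBelow.sum {ι : Type*} {w : ℕ} {s : Finset ι} {f : ι → FormalSeries}
    (hf : ∀ i ∈ s, VanishesBelow w (f i)) : VanishesBelow w (∑ i ∈ s, f i) := fun m hm => by
  rw [map_sum]
  exact Finset.sum_eq_zero fun i hi => hf i hi m hm

lemma VanishesBelow.mul {v w : ℕ} {f g : FormalSeries} (hf : VanishesBelow v f)
    (hg : VanishesBelow w g) : VanishesBelow (v + w) (f * g) := fun m hm => by
  classical
  rw [coeff_mul]
  refine Finset.sum_eq_zero fun p hp => ?_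
  rw [Finset.HasAntidiagonal.mem_antidiagonal] at hp
  have h0 : p.1 0 + p.2 0 = m 0 := by rw [← hp]; rfl
  have h1 : p.1 1 + p.2 1 = m 1 := by rw [← hp]; rfl
  by_cases h : p.1 0 + 2 * p.1 1 < v
  · rw [hf _ h, zero_mul]
  · rw [hg _ (by omega), mul_zero]

lemma vanishesBelow_one_iff {f : FormalSeries} :
    VanishesBelow 1 f ↔ constantCoeff f = 0 := by
  rw [← coeff_zero_eq_constantCoeff_apply]
  constructor
  · intro h
    exact h 0 (by simp)
  · intro h m hm
    have : m = 0 := by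
      ext i
      fin_cases i
      · simp; omega
      · simp; omega
    rw [this, h]

lemma vanishesBelow_one_X (s : Fin 2) : VanishesBelow 1 (X s : FormalSeries) := by
  rw [vanishesBelow_one_iff]
  simp

lemma eq_of_forall_vanishesBelow_sub {f g : FormalSeries} (h : ∀ w, VanishesBelow w (f - g)) :
    f = g := by
  ext m
  have := h (m 0 + 2 * m 1 + 1) m (by omega)
  rwa [map_sub, sub_eq_zero] at this

/-- The value of the monomial with multi-index `d` at `a`. -/
abbrev monomialValue {σ : Type*} (a : σ → FormalSeries) (d : σ →₀ ℕ) : FormalSeries :=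
  d.prod fun s e => a s ^ e

lemma monomialValue_add_single {σ : Type*} (a : σ → FormalSeries) (d : σ →₀ ℕ) (s : σ) :
    monomialValue a (d + Finsupp.single s 1) = monomialValue a d * a s := by
  classical
  unfold monomialValue
  rw [Finsupp.prod_add_index' (by simp) (by simp [pow_add])]
  simp

lemma finsupp_eq_add_single {σ : Type*} {d : σ →₀ ℕ} (hd : d ≠ 0) :
    ∃ (e : σ →₀ ℕ) (s : σ), d = e + Finsupp.single s 1 := by
  classical
  obtain ⟨s, hs⟩ := Finsupp.ne_iff.1 hd
  refine ⟨d - Finsupp.single s 1, s, ?_⟩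
  rw [tsub_add_cancel_of_le]
  rw [Finsupp.single_le_iff]
  simp at hs
  omega

lemma vanishesBelow_monomialValue {σ : Type*} {a : σ → FormalSeries}
    (ha : ∀ s, VanishesBelow 1 (a s)) (n : ℕ) :
    ∀ d : σ →₀ ℕ, d.degree = n → VanishesBelow n (monomialValue a d) := by
  induction n with
  | zero => intro d _; exact vanishesBelow_zero_left _
  | succ n ih =>
    intro d hd
    obtain ⟨e, s, rfl⟩ := finsupp_eq_add_single (d := d) (by rintro rfl; simp at hd)
    rw [monomialValue_add_single]
    refine (ih e ?_).mul (ha s)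
    simpa using hd

/-- Telescoping: one factor is replaced by its difference, of order `w`, and each of the `n` other
factors contributes order 1. -/
lemma vanishesBelow_monomialValue_sub {σ : Type*} {a b : σ → FormalSeries} {w : ℕ}
    (ha : ∀ s, VanishesBelow 1 (a s)) (hb : ∀ s, VanishesBelow 1 (b s))
    (hab : ∀ s, VanishesBelow w (a s - b s)) (n : ℕ) :
    ∀ d : σ →₀ ℕ, d.degree = n + 1 →
      VanishesBelow (w + n) (monomialValue a d - monomialValue b d) := by
  induction n with
  | zero =>
    intro d hd
    obtain ⟨e, s, rfl⟩ := finsupp_eq_add_single (d := d) (by rintro rfl; simp at hd)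
    have he : e = 0 := by simpa [Finsupp.degree_eq_zero_iff] using hd
    subst he
    simpa [monomialValue] using hab s
  | succ n ih =>
    intro d hd
    obtain ⟨e, s, rfl⟩ := finsupp_eq_add_single (d := d) (by rintro rfl; simp at hd)
    have he : e.degree = n + 1 := by simpa using hd
    rw [monomialValue_add_single, monomialValue_add_single]
    have : monomialValue a e * a s - monomialValue b e * b s =
      monomialValue a e * (a s - b s) + (monomialValue a e - monomialValue b e) * b s := by ring
    rw [this]
    exact (((vanishesBelow_monomialValue ha _ e he).mul (hab s)).mono (by omega)).add
      (((ih e he).mul (hb s)).mono (by omega))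

/-! ### Effect of substitution and of the q-derivative on the order -/

/-- Substitution of `(x, ε, y)` for the variables. -/
abbrev substPoint {N : ℕ} (y : Fin N → FormalSeries) : Fin 2 ⊕ Fin N → FormalSeries :=
  Sum.elim (fun s : Fin 2 => (X s : FormalSeries)) y

lemma vanishesBelow_substPoint {N : ℕ} {y : Fin N → FormalSeries}
    (hy : ∀ i, VanishesBelow 1 (y i)) (s : Fin 2 ⊕ Fin N) : VanishesBelow 1 (substPoint y s) := by
  cases s with
  | inl s => exact vanishesBelow_one_X s
  | inr j => exact hy j

lemma hasSubst_substPoint {N : ℕ} {y : Fin N → FormalSeries}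
    (hy : ∀ i, VanishesBelow 1 (y i)) : HasSubst (substPoint y) :=
  hasSubst_of_constantCoeff_zero fun s =>
    vanishesBelow_one_iff.1 (vanishesBelow_substPoint hy s)

lemma vanishesBelow_subst {N : ℕ} {y : Fin N → FormalSeries}
    (hy : ∀ i, VanishesBelow 1 (y i)) {g : MvPowerSeries (Fin 2 ⊕ Fin N) ℂ}
    (hg : coeff 0 g = 0) : VanishesBelow 1 (subst (substPoint y) g) := by
  intro m hm
  rw [coeff_subst (hasSubst_substPoint hy)]
  refine finsum_eq_zero_of_forall_eq_zero fun d => ?_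
  by_cases hd : d = 0
  · rw [hd, hg, zero_smul]
  · rw [vanishesBelow_monomialValue (vanishesBelow_substPoint hy) _ d rfl m, smul_zero]
    have : d.degree ≠ 0 := by simpa [Finsupp.degree_eq_zero_iff] using hd
    omega

/-- The constant term and the terms linear in `x`, `ε` cancel, those linear in `y` are absent by
`hg`, and a monomial of degree at least 2 has a spare factor of order 1. -/
lemma vanishesBelow_subst_sub {N : ℕ} {y z : Fin N → FormalSeries} {w : ℕ}
    (hy : ∀ i, VanishesBelow 1 (y i)) (hz : ∀ i, VanishesBelow 1 (z i))
    (hyz : ∀ i, VanishesBelow w (y i - z i)) {g : MvPowerSeries (Fin 2 ⊕ Fin N) ℂ}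
    (hg : ∀ j, coeff (Finsupp.single (Sum.inr j) 1) g = 0) :
    VanishesBelow (w + 1) (subst (substPoint y) g - subst (substPoint z) g) := by
  intro m hm
  rw [map_sub, coeff_subst (hasSubst_substPoint hy), coeff_subst (hasSubst_substPoint hz),
    ← finsum_sub_distrib (coeff_subst_finite (hasSubst_substPoint hy) _ _)
      (coeff_subst_finite (hasSubst_substPoint hz) _ _)]
  refine finsum_eq_zero_of_forall_eq_zero fun d => ?_
  have hab : ∀ s, VanishesBelow w (substPoint y s - substPoint z s) := by
    rintro (s | j)
    · simpa using vanishesBelow_zero w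
    · exact hyz j
  rw [← smul_sub, ← map_sub]
  rcases hd : d.degree with _ | _ | n
  · have : d = 0 := by simpa [Finsupp.degree_eq_zero_iff] using hd
    simp [this]
  · obtain ⟨e, s, rfl⟩ := finsupp_eq_add_single (d := d) (by rintro rfl; simp at hd)
    have he : e = 0 := by simpa [Finsupp.degree_eq_zero_iff] using hd
    subst he
    rcases s with s | j
    · simp
    · rw [zero_add, hg, zero_smul]
  · rw [vanishesBelow_monomialValue_sub (vanishesBelow_substPoint hy)
      (vanishesBelow_substPoint hz) hab _ d hd m (by omega), smul_zero]

lemma coeff_qDeriv (q : ℂ) (f : FormalSeries) (m : Fin 2 →₀ ℕ) :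
    coeff m (qDeriv q f) = qNumber q (m 0 + 1) * coeff (m + Finsupp.single 0 1) f := rfl

lemma qDeriv_sub (q : ℂ) (f g : FormalSeries) :
    qDeriv q (f - g) = qDeriv q f - qDeriv q g := by
  ext m
  simp only [coeff_qDeriv, map_sub, mul_sub]

lemma coeff_X_pow_mul_qDeriv (q : ℂ) (α : ℕ) (f : FormalSeries) (m : Fin 2 →₀ ℕ) :
    coeff m ((X 1 : FormalSeries) ^ α * qDeriv q f) =
      if α ≤ m 1 then qNumber q (m 0 + 1) *
        coeff (m - Finsupp.single 1 α + Finsupp.single 0 1) f else 0 := by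
  classical
  rw [X_pow_eq, coeff_monomial_mul, one_mul]
  simp only [Finsupp.single_le_iff]
  split_ifs
  · rw [coeff_qDeriv]; simp
  · rfl

/-- The derivative loses 1 and `ε ^ α` gains `2 α`. With weight 1 on `ε` there would be no net gain
for `α = 1`. -/
lemma VanishesBelow.X_pow_mul_qDeriv {q : ℂ} {α : ℕ} (hα : 0 < α) {w : ℕ} {f : FormalSeries}
    (hf : VanishesBelow w f) : VanishesBelow (w + 1) ((X 1 : FormalSeries) ^ α * qDeriv q f) := by
  intro m hm
  rw [coeff_X_pow_mul_qDeriv]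
  split_ifs with h
  · rw [hf, mul_zero]
    simp
    omega
  · rfl

/-! ### Weighted `ℓ¹` norms, products and composition -/

section WeightedNorm

/-- The weighted `ℓ¹` norm `∑ |f_m| W_m` of a power series. -/
def wnorm (W : (Fin 2 →₀ ℕ) → ENNReal) (f : FormalSeries) : ENNReal :=
  ∑' m, ‖coeff m f‖ₑ * W m

/-- A weight on the monomials for which `wnorm` is submultiplicative. -/
structure IsSubmultWeight (W : (Fin 2 →₀ ℕ) → ENNReal) : Prop where
  zero_le_one : W 0 ≤ 1
  add_le : ∀ a b, W (a + b) ≤ W a * W b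

variable {W : (Fin 2 →₀ ℕ) → ENNReal}

lemma wnorm_monomial (m : Fin 2 →₀ ℕ) : wnorm W (monomial m (1 : ℂ)) = W m := by
  classical
  unfold wnorm
  rw [tsum_eq_single m]
  · simp
  · intro m' h
    rw [coeff_monomial, if_neg h]
    simp

lemma wnorm_zero : wnorm W 0 = 0 := by simp [wnorm]

lemma wnorm_add_le (f g : FormalSeries) : wnorm W (f + g) ≤ wnorm W f + wnorm W g := by
  unfold wnorm
  rw [← ENNReal.tsum_add]
  refine ENNReal.tsum_le_tsum fun m => ?_
  rw [← add_mul, map_add]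
  gcongr
  exact enorm_add_le _ _

lemma wnorm_sub_le (f g : FormalSeries) : wnorm W (f - g) ≤ wnorm W f + wnorm W g := by
  unfold wnorm
  rw [← ENNReal.tsum_add]
  refine ENNReal.tsum_le_tsum fun m => ?_
  rw [← add_mul, map_sub]
  gcongr
  exact enorm_sub_le

lemma wnorm_smul (c : ℂ) (f : FormalSeries) : wnorm W (c • f) = ‖c‖ₑ * wnorm W f := by
  unfold wnorm
  rw [← ENNReal.tsum_mul_left]
  refine tsum_congr fun m => ?_
  rw [coeff_smul, enorm_mul, mul_assoc]

lemma wnorm_sum_le {ι : Type*} (s : Finset ι) (f : ι → FormalSeries) :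
    wnorm W (∑ i ∈ s, f i) ≤ ∑ i ∈ s, wnorm W (f i) := by
  classical
  induction s using Finset.induction_on with
  | empty => simp [wnorm_zero]
  | insert i s hi ih =>
    rw [Finset.sum_insert hi, Finset.sum_insert hi]
    exact (wnorm_add_le _ _).trans (by gcongr)

lemma wnorm_mul_le (hW : IsSubmultWeight W) (f g : FormalSeries) :
    wnorm W (f * g) ≤ wnorm W f * wnorm W g := by
  classical
  have h1 : wnorm W f * wnorm W g = ∑' p : (Fin 2 →₀ ℕ) × (Fin 2 →₀ ℕ),
      (‖coeff p.1 f‖ₑ * W p.1) * (‖coeff p.2 g‖ₑ * W p.2) := by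
    rw [ENNReal.tsum_prod (f := fun a b => (‖coeff a f‖ₑ * W a) * (‖coeff b g‖ₑ * W b))]
    simp_rw [ENNReal.tsum_mul_left, ENNReal.tsum_mul_right]
    rfl
  rw [h1, ← Finset.HasAntidiagonal.sigmaAntidiagonalEquivProd.tsum_eq, ENNReal.tsum_sigma']
  refine ENNReal.tsum_le_tsum fun m => ?_
  rw [tsum_fintype, coeff_mul]
  simp only [Finset.HasAntidiagonal.sigmaAntidiagonalEquivProd_apply]
  rw [Finset.sum_coe_sort (Finset.HasAntidiagonal.antidiagonal m)
    (fun p => (‖coeff p.1 f‖ₑ * W p.1) * (‖coeff p.2 g‖ₑ * W p.2))]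
  refine (mul_le_mul_left (enorm_sum_le _ _) _).trans ?_
  rw [Finset.sum_mul]
  refine Finset.sum_le_sum fun p hp => ?_
  rw [Finset.HasAntidiagonal.mem_antidiagonal] at hp
  rw [enorm_mul, ← hp]
  calc _ ≤ ‖coeff p.1 f‖ₑ * ‖coeff p.2 g‖ₑ * (W p.1 * W p.2) := by
        gcongr; exact hW.add_le _ _
    _ = _ := by ring

lemma wnorm_one_le (hW : IsSubmultWeight W) : wnorm W 1 ≤ 1 := by
  have : (1 : FormalSeries) = monomial 0 1 := rfl
  rw [this, wnorm_monomial]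
  exact hW.zero_le_one

lemma wnorm_monomialValue_le {σ : Type*} [Fintype σ] (hW : IsSubmultWeight W)
    {a : σ → FormalSeries} {R : ENNReal} (ha : ∀ s, wnorm W (a s) ≤ R) (n : ℕ) :
    ∀ d : σ →₀ ℕ, d.degree = n → wnorm W (monomialValue a d) ≤ R ^ n := by
  induction n with
  | zero =>
    intro d hd
    have : d = 0 := by simpa [Finsupp.degree_eq_zero_iff] using hd
    subst this
    simpa [monomialValue] using wnorm_one_le hW
  | succ n ih =>
    intro d hd
    obtain ⟨e, s, rfl⟩ := finsupp_eq_add_single (d := d) (by rintro rfl; simp at hd)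
    rw [monomialValue_add_single, pow_succ]
    refine (wnorm_mul_le hW _ _).trans ?_
    gcongr
    · exact ih e (by simpa using hd)
    · exact ha s

/-- Triangle inequality in each coefficient, where the sum is finite, followed by an exchange of the
two sums in `ENNReal`. -/
lemma wnorm_subst_le {σ : Type*} {a : σ → FormalSeries} (ha : HasSubst a)
    (g : MvPowerSeries σ ℂ) :
    wnorm W (subst a g) ≤ ∑' d, ‖coeff d g‖ₑ * wnorm W (monomialValue a d) := by
  unfold wnorm
  simp_rw [← ENNReal.tsum_mul_left]
  rw [ENNReal.tsum_comm]
  refine ENNReal.tsum_le_tsum fun m => ?_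
  simp_rw [← mul_assoc]
  rw [ENNReal.tsum_mul_right]
  gcongr
  rw [coeff_subst ha, ← tsum_eq_finsum (L := SummationFilter.unconditional _)
    (coeff_subst_finite ha g m)]
  refine enorm_tsum_le_tsum_enorm.trans ?_
  simp only [smul_eq_mul, enorm_mul, monomialValue]
  rfl

lemma finsupp_tsum_multinomial {σ : Type*} [Fintype σ] (t : ENNReal) (n : ℕ) :
    ∑' d : σ →₀ ℕ, (if d.degree = n then (Nat.multinomial Finset.univ d : ENNReal) * t ^ n else 0)
      = (Fintype.card σ * t) ^ n := by
  classical
  have h := Finset.sum_pow_eq_sum_piAntidiag (Finset.univ : Finset σ) (fun _ => t) n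
  rw [Finset.sum_const, Finset.card_univ, nsmul_eq_mul] at h
  rw [h, ← Finsupp.equivFunOnFinite.symm.tsum_eq,
    tsum_eq_sum (s := Finset.piAntidiag Finset.univ n)]
  · refine Finset.sum_congr rfl fun k hk => ?_
    have hk' : ∑ i, k i = n := by simpa using hk
    rw [if_pos]
    · rw [Finset.prod_pow_eq_pow_sum, hk']; rfl
    · rw [Finsupp.degree_eq_sum]; simpa using hk'
  · intro k hk
    rw [if_neg]
    rw [Finsupp.degree_eq_sum]
    simpa using hk

end WeightedNorm

open NNReal ENNReal

/-- Sum by total degree with the multinomial theorem. Degree 1 involves only `x` and `ε`, so it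
costs `ρ` instead of `R`; degrees at least 2 form a geometric series of ratio at most `1/2`, whence
the factor 2. This leaves `R` only quadratically, which makes a small ball invariant. -/
lemma wnorm_subst_le_of_coeff_le {N : ℕ} {W : (Fin 2 →₀ ℕ) → ENNReal} (hW : IsSubmultWeight W)
    {y : Fin N → FormalSeries} (hy1 : ∀ i, VanishesBelow 1 (y i))
    {g : MvPowerSeries (Fin 2 ⊕ Fin N) ℂ} (hg0 : coeff 0 g = 0)
    (hg1 : ∀ j, coeff (Finsupp.single (Sum.inr j) 1) g = 0) {C K ρ R : ENNReal}
    (hg : ∀ d, ‖coeff d g‖ₑ ≤ C * Nat.multinomial Finset.univ d * K ^ d.degree)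
    (hX : ∀ s : Fin 2, wnorm W (X s : FormalSeries) ≤ ρ) (hy : ∀ i, wnorm W (y i) ≤ R)
    (hρ : ρ ≤ R) (hR : ((N + 2 : ℕ) : ENNReal) * K * R ≤ 2⁻¹) :
    wnorm W (subst (substPoint y) g) ≤
      C * (((N + 2 : ℕ) : ENNReal) * K * ρ + 2 * (((N + 2 : ℕ) : ENNReal) * K * R) ^ 2) := by
  classical
  set L : ENNReal := ((N + 2 : ℕ) : ENNReal) * K with hL
  let c : ℕ → ENNReal := fun n => match n with
    | 0 => 0
    | 1 => ρ
    | n + 2 => R ^ (n + 2)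
  have hyR : ∀ s, wnorm W (substPoint y s) ≤ R := by
    rintro (s | j)
    · exact (hX s).trans hρ
    · exact hy j
  have key : ∀ d, ‖coeff d g‖ₑ * wnorm W (monomialValue (substPoint y) d) ≤
      ∑' n, C * c n * (if d.degree = n then
        (Nat.multinomial Finset.univ d : ENNReal) * K ^ n else 0) := by
    intro d
    rw [tsum_eq_single d.degree (by intro n hn; rw [if_neg hn.symm, mul_zero]), if_pos rfl]
    have : ‖coeff d g‖ₑ * wnorm W (monomialValue (substPoint y) d) ≤ ‖coeff d g‖ₑ * c d.degree := by
      rcases hd : d.degree with _ | _ | n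
      · have : d = 0 := by simpa [Finsupp.degree_eq_zero_iff] using hd
        subst this
        simp [hg0]
      · obtain ⟨e, s, rfl⟩ := finsupp_eq_add_single (d := d) (by rintro rfl; simp at hd)
        have he : e = 0 := by simpa [Finsupp.degree_eq_zero_iff] using hd
        subst he
        rcases s with s | j
        · gcongr
          have : monomialValue (substPoint y) (0 + Finsupp.single (Sum.inl s) 1) = X s := by
            simp [monomialValue]
          rw [this]
          exact hX s
        · rw [zero_add, hg1]
          simp
      · gcongr
        exact wnorm_monomialValue_le hW hyR _ d hd
    refine this.trans ?_
    calc _ ≤ C * Nat.multinomial Finset.univ d * K ^ d.degree * c d.degree := by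
          gcongr; exact hg d
      _ = _ := by ring
  refine (wnorm_subst_le (hasSubst_substPoint hy1) g).trans ?_
  refine (ENNReal.tsum_le_tsum key).trans ?_
  rw [ENNReal.tsum_comm]
  simp_rw [ENNReal.tsum_mul_left, finsupp_tsum_multinomial]
  have hcard : Fintype.card (Fin 2 ⊕ Fin N) = N + 2 := by simp [add_comm]
  rw [hcard, ← hL]
  clear_value L
  simp_rw [mul_assoc C]
  rw [ENNReal.tsum_mul_left]
  gcongr
  rw [tsum_eq_zero_add' ENNReal.summable, tsum_eq_zero_add' ENNReal.summable]
  simp only [c, zero_mul, zero_add, pow_one]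
  rw [mul_comm ρ L]
  gcongr
  calc ∑' n, R ^ (n + 2) * L ^ (n + 2)
      = ∑' n, (L * R) ^ 2 * (L * R) ^ n := by
        refine tsum_congr fun n => ?_
        rw [← pow_add, mul_pow, add_comm 2 n, mul_comm]
    _ ≤ ∑' n, (L * R) ^ 2 * 2⁻¹ ^ n := by
        refine ENNReal.tsum_le_tsum fun n => ?_
        gcongr
    _ = _ := by rw [ENNReal.tsum_mul_left, ENNReal.tsum_geometric_two, mul_comm]

/-! ### The q-Gevrey weight -/

/-- The triangular number `n (n + 1) / 2`. -/
def triangular (n : ℕ) : ℕ := n * (n + 1) / 2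

lemma two_mul_triangular (n : ℕ) : 2 * triangular n = n * (n + 1) :=
  Nat.two_mul_div_two_of_even (Nat.even_mul_succ_self n)

lemma triangular_succ (n : ℕ) : triangular (n + 1) = triangular n + (n + 1) := by
  have h1 := two_mul_triangular n
  have h2 := two_mul_triangular (n + 1)
  nlinarith

lemma triangular_mono : Monotone triangular :=
  monotone_nat_of_le_succ fun n => by rw [triangular_succ]; omega

lemma triangular_add_le (a b : ℕ) : triangular a + triangular b ≤ triangular (a + b) := by
  have h1 := two_mul_triangular a
  have h2 := two_mul_triangular b
  have h3 := two_mul_triangular (a + b)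
  nlinarith [Nat.zero_le (a * b)]

/-- The weight of `x ^ k * ε ^ n`: with `l = ⌊n / α⌋` it is
`(r / Q ^ l) ^ k * s ^ n / Q ^ (l (l + 1) / 2)`. -/
def gevreyWeight (Q r s : ℝ≥0) (α : ℕ) (m : Fin 2 →₀ ℕ) : ENNReal :=
  (((r / Q ^ (m 1 / α)) ^ m 0 * s ^ m 1 / Q ^ triangular (m 1 / α) : ℝ≥0) : ENNReal)

/-- Both `n ↦ ⌊n / α⌋` and the triangular numbers are superadditive and monotone, and they occur as
exponents of `Q > 1` in denominators. -/
lemma isSubmultWeight_gevreyWeight {Q : ℝ≥0} (hQ : 1 < Q) (r s : ℝ≥0) (α : ℕ) :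
    IsSubmultWeight (gevreyWeight Q r s α) where
  zero_le_one := by simp [gevreyWeight, triangular]
  add_le a b := by
    unfold gevreyWeight
    rw [← ENNReal.coe_mul, ENNReal.coe_le_coe]
    have h0 : 0 < Q := by positivity
    have hdiv : a 1 / α + b 1 / α ≤ (a 1 + b 1) / α := Nat.div_add_div_le_add_div
    have hT : triangular (a 1 / α) + triangular (b 1 / α) ≤ triangular ((a 1 + b 1) / α) :=
      (triangular_add_le _ _).trans (triangular_mono hdiv)
    simp only [Finsupp.add_apply]
    calc (r / Q ^ ((a 1 + b 1) / α)) ^ (a 0 + b 0) * s ^ (a 1 + b 1) /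
            Q ^ triangular ((a 1 + b 1) / α)
        = (r / Q ^ ((a 1 + b 1) / α)) ^ a 0 * (r / Q ^ ((a 1 + b 1) / α)) ^ b 0
          * s ^ (a 1 + b 1) / Q ^ triangular ((a 1 + b 1) / α) := by rw [pow_add]
      _ ≤ (r / Q ^ (a 1 / α)) ^ a 0 * (r / Q ^ (b 1 / α)) ^ b 0
          * s ^ (a 1 + b 1) / Q ^ (triangular (a 1 / α) + triangular (b 1 / α)) := by
        gcongr
        · exact hQ.le
        · omega
        · exact hQ.le
        · omega
        · exact hQ.le
      _ = _ := by rw [pow_add, pow_add]; field_simp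

/-- With `k = m 0` and `l = ⌊(m 1 - α) / α⌋`, passing from `x ^ (k + 1) ε ^ (m 1 - α)` to `x ^ k ε ^
(m 1)` divides the weight by `Q ^ k` (smaller radius) and by `Q ^ (l + 1)` (triangular step), and
the lost power of `x` gives back `Q ^ l`. The net `Q ^ (k + 1)` exactly balances `|[k + 1]_q| ≤ 2 Q
^ (k + 1) / |q - 1|`. -/
lemma enorm_qNumber_succ_mul_gevreyWeight_le {q : ℂ} (hq : 1 < ‖q‖) {r : ℝ≥0} (hr : 0 < r) (s : ℝ≥0)
    {α : ℕ} (hα : 0 < α) (m : Fin 2 →₀ ℕ) (hm : α ≤ m 1) :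
    ‖qNumber q (m 0 + 1)‖ₑ * gevreyWeight ‖q‖₊ r s α m ≤
      ((2 / ‖q - 1‖₊ * s ^ α / r : ℝ≥0) : ENNReal) *
        gevreyWeight ‖q‖₊ r s α (m - Finsupp.single 1 α + Finsupp.single 0 1) := by
  obtain ⟨n, hn⟩ := Nat.exists_eq_add_of_le' hm
  have hQ : 1 < ‖q‖₊ := hq
  have hQ0 : 0 < ‖q‖₊ := by positivity
  have hq1 : 0 < ‖q - 1‖₊ := by
    rw [nnnorm_pos, sub_ne_zero]
    rintro rfl
    simp at hq
  unfold gevreyWeight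
  have e1 : (m - Finsupp.single 1 α + Finsupp.single 0 1 : Fin 2 →₀ ℕ) 0 = m 0 + 1 := by simp
  have e2 : (m - Finsupp.single 1 α + Finsupp.single 0 1 : Fin 2 →₀ ℕ) 1 = n := by simp [hn]
  rw [e1, e2, hn, Nat.add_div_right _ hα, triangular_succ, enorm_eq_nnnorm,
    ← ENNReal.coe_mul, ← ENNReal.coe_mul, ENNReal.coe_le_coe]
  have hnum : ‖qNumber q (m 0 + 1)‖₊ ≤ 2 * ‖q‖₊ ^ (m 0 + 1) / ‖q - 1‖₊ := by
    unfold qNumber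
    rw [nnnorm_div]
    gcongr
    refine (nnnorm_sub_le _ _).trans ?_
    rw [nnnorm_pow, nnnorm_one, two_mul]
    gcongr
    exact one_le_pow₀ hQ.le
  refine (mul_le_mul_left hnum _).trans (le_of_eq ?_)
  set Q := ‖q‖₊
  simp only [div_pow, pow_succ, pow_add, mul_pow]
  field_simp

/-- The termwise estimate can be summed because the index shift is injective on the exponents with
`α ≤ m 1`, outside which the coefficients vanish. -/
lemma wnorm_X_pow_mul_qDeriv_le {q : ℂ} (hq : 1 < ‖q‖) {r : ℝ≥0} (hr : 0 < r) (s : ℝ≥0)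
    {α : ℕ} (hα : 0 < α) (f : FormalSeries) :
    wnorm (gevreyWeight ‖q‖₊ r s α) ((X 1 : FormalSeries) ^ α * qDeriv q f) ≤
      ((2 / ‖q - 1‖₊ * s ^ α / r : ℝ≥0) : ENNReal) * wnorm (gevreyWeight ‖q‖₊ r s α) f := by
  classical
  unfold wnorm
  set W := gevreyWeight ‖q‖₊ r s α
  rw [← ENNReal.tsum_mul_left]
  let S : Set (Fin 2 →₀ ℕ) := {m | α ≤ m 1}
  let φ : S → (Fin 2 →₀ ℕ) := fun m => m.1 - Finsupp.single 1 α + Finsupp.single 0 1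
  have hφ : Function.Injective φ := by
    intro a b hab
    have h := add_right_cancel hab
    have ha : Finsupp.single 1 α ≤ a.1 := by rw [Finsupp.single_le_iff]; exact a.2
    have hb : Finsupp.single 1 α ≤ b.1 := by rw [Finsupp.single_le_iff]; exact b.2
    exact Subtype.ext (tsub_left_inj ha hb |>.1 h)
  refine le_trans ?_ (ENNReal.tsum_comp_le_tsum_of_injective hφ _)
  rw [← tsum_subtype_eq_of_support_subset (s := S)]
  · refine ENNReal.tsum_le_tsum fun m => ?_
    rw [coeff_X_pow_mul_qDeriv, if_pos (show α ≤ m.1 1 from m.2), enorm_mul]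
    calc _ = ‖coeff (φ m) f‖ₑ * (‖qNumber q (m.1 0 + 1)‖ₑ * W m) := by
          simp only [φ]; ring
      _ ≤ ‖coeff (φ m) f‖ₑ * (((2 / ‖q - 1‖₊ * s ^ α / r : ℝ≥0) : ENNReal) * W (φ m)) := by
          exact mul_le_mul' le_rfl (enorm_qNumber_succ_mul_gevreyWeight_le hq hr s hα m.1 m.2)
      _ = _ := by ring
  · intro m hm
    by_contra h
    refine hm ?_
    simp only
    rw [coeff_X_pow_mul_qDeriv, if_neg (show ¬ α ≤ m 1 from h)]
    simp

lemma wnorm_X_zero (Q r s : ℝ≥0) {α : ℕ} :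
    wnorm (gevreyWeight Q r s α) (X 0 : FormalSeries) = r := by
  rw [X, wnorm_monomial]
  simp [gevreyWeight, triangular]

lemma wnorm_X_one_le {Q : ℝ≥0} (hQ : 1 < Q) (r s : ℝ≥0) {α : ℕ} :
    wnorm (gevreyWeight Q r s α) (X 1 : FormalSeries) ≤ s := by
  rw [X, wnorm_monomial]
  unfold gevreyWeight
  rw [ENNReal.coe_le_coe]
  simp only [Finsupp.single_apply, if_true]
  simp
  exact div_le_self (by positivity) (one_le_pow₀ hQ.le)

/-! ### Taylor coefficients and Jacobian of `F` -/

lemma norm_basisVec_le {N : ℕ} (s : Fin 2 ⊕ Fin N) : ‖(basisVec s : ℂ × ℂ × (Fin N → ℂ))‖ ≤ 1 := by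
  rcases s with s | j
  · fin_cases s <;> simp [basisVec, Prod.norm_def]
  · have : ‖(Pi.single j 1 : Fin N → ℂ)‖ ≤ 1 := by
      rw [pi_norm_le_iff_of_nonneg zero_le_one]
      intro i
      rw [Pi.single_apply]
      split_ifs <;> simp
    simpa [basisVec, Prod.norm_def] using this

/-- The iterated derivative is a sum over `|d|!` permutations of a term of the power series, bounded
by `C K ^ |d|`; dividing by `d!` produces the multinomial coefficient. -/
lemma exists_norm_coeff_taylorSeries_le {N : ℕ} {F : ℂ × ℂ × (Fin N → ℂ) → Fin N → ℂ}
    (hF : AnalyticAt ℂ F 0) : ∃ C K : ℝ≥0, ∀ i d,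
      ‖coeff d (taylorSeries F i)‖ₑ ≤ (C : ENNReal) * Nat.multinomial Finset.univ d *
        (K : ENNReal) ^ d.degree := by
  obtain ⟨p, ρ, hp⟩ := hF
  obtain ⟨C, K, hC, hK, hpn⟩ := p.le_mul_pow_of_radius_pos hp.radius_pos
  lift C to ℝ≥0 using hC.le
  lift K to ℝ≥0 using hK.le
  refine ⟨C, K, fun i d => ?_⟩
  have hcard : (Finsupp.toMultiset d).toList.length = d.degree := by
    rw [Multiset.length_toList, Finsupp.card_toMultiset]
    rfl
  have hder : ‖partialDeriv F d‖ ≤ (d.degree.factorial : ℝ) * (C * K ^ d.degree) := by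
    unfold partialDeriv
    rw [hp.iteratedFDeriv_eq_sum_of_completeSpace]
    refine (norm_sum_le _ _).trans ?_
    have : ∀ σ ∈ (Finset.univ : Finset (Equiv.Perm (Fin (Finsupp.toMultiset d).toList.length))),
        ‖(p (Finsupp.toMultiset d).toList.length) fun k =>
          basisVec ((Finsupp.toMultiset d).toList.get (σ k))‖ ≤ C * K ^ d.degree := by
      intro σ _
      refine (ContinuousMultilinearMap.le_opNorm _ _).trans ?_
      rw [← hcard]
      refine le_trans ?_ (hpn _)
      refine mul_le_of_le_one_right (norm_nonneg _) ?_
      exact Finset.prod_le_one (fun _ _ => norm_nonneg _) fun _ _ => norm_basisVec_le _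
    refine (Finset.sum_le_card_nsmul _ _ _ this).trans (le_of_eq ?_)
    rw [Finset.card_univ, Fintype.card_perm, Fintype.card_fin, nsmul_eq_mul, hcard]
  have hspec := Nat.multinomial_spec Finset.univ d
  rw [← Finsupp.degree_eq_sum] at hspec
  have hprod : (0 : ℝ) < ∏ s, ((d s).factorial : ℝ) :=
    Finset.prod_pos fun s _ => by exact_mod_cast Nat.factorial_pos _
  have hreal : ‖coeff d (taylorSeries F i)‖ ≤
      C * Nat.multinomial Finset.univ d * K ^ d.degree := by
    have h1 : coeff d (taylorSeries F i) = partialDeriv F d i / ∏ s, ((d s).factorial : ℂ) := rfl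
    rw [h1, norm_div, norm_prod]
    simp only [Complex.norm_natCast]
    rw [div_le_iff₀ hprod]
    refine (norm_le_pi_norm _ i).trans (hder.trans (le_of_eq ?_))
    rw [← hspec]
    push_cast
    ring
  rw [enorm_eq_nnnorm]
  exact_mod_cast hreal

lemma coeff_zero_taylorSeries {N : ℕ} {F : ℂ × ℂ × (Fin N → ℂ) → Fin N → ℂ}
    (hF0 : F 0 = 0) (i : Fin N) : coeff 0 (taylorSeries F i) = 0 := by
  have h1 : coeff 0 (taylorSeries F i) =
    partialDeriv F 0 i / ∏ s, (((0 : Fin 2 ⊕ Fin N →₀ ℕ) s).factorial : ℂ) := rfl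
  -- The list is generalized because the type of the arguments depends on its length.
  have h2 : ∀ l : List (Fin 2 ⊕ Fin N), l = [] →
      iteratedFDeriv ℂ l.length F 0 (fun k => basisVec (l.get k)) = 0 := by
    rintro l rfl
    simpa using hF0
  rw [h1, partialDeriv, h2 _ (by simp)]
  simp

/-- The Jacobian matrix of `F` with respect to `y` at the origin. -/
def jacobian {N : ℕ} (F : ℂ × ℂ × (Fin N → ℂ) → Fin N → ℂ) : Matrix (Fin N) (Fin N) ℂ :=
  LinearMap.toMatrix' (fderiv ℂ (fun y : Fin N → ℂ => F (0, 0, y)) 0 : (Fin N → ℂ) →ₗ[ℂ] Fin N → ℂ)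

lemma coeff_single_inr_taylorSeries {N : ℕ} {F : ℂ × ℂ × (Fin N → ℂ) → Fin N → ℂ}
    (hF : AnalyticAt ℂ F 0) (i j : Fin N) :
    coeff (Finsupp.single (Sum.inr j) 1) (taylorSeries F i) = jacobian F i j := by
  classical
  have h1 : coeff (Finsupp.single (Sum.inr j) 1) (taylorSeries F i) =
    partialDeriv F (Finsupp.single (Sum.inr j) 1) i /
      ∏ s, (((Finsupp.single (Sum.inr j) 1 : Fin 2 ⊕ Fin N →₀ ℕ) s).factorial : ℂ) := rfl
  have h2 : ∀ l : List (Fin 2 ⊕ Fin N), l = [Sum.inr j] →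
      iteratedFDeriv ℂ l.length F 0 (fun k => basisVec (l.get k)) =
        fderiv ℂ F 0 (basisVec (Sum.inr j)) := by
    rintro l rfl
    exact iteratedFDeriv_one_apply _
  have h3 : ∏ s, (((Finsupp.single (Sum.inr j) 1 : Fin 2 ⊕ Fin N →₀ ℕ) s).factorial : ℂ) = 1 := by
    refine Finset.prod_eq_one fun s _ => ?_
    rw [Finsupp.single_apply]
    split_ifs <;> simp
  have h4 : fderiv ℂ (fun y : Fin N → ℂ => F (0, 0, y)) 0 (Pi.single j 1) =
      fderiv ℂ F 0 (0, 0, Pi.single j 1) := by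
    have hl : HasFDerivAt (fun y : Fin N → ℂ => ((0, 0, y) : ℂ × ℂ × (Fin N → ℂ)))
        ((ContinuousLinearMap.inr ℂ ℂ (ℂ × (Fin N → ℂ))).comp
          (ContinuousLinearMap.inr ℂ ℂ (Fin N → ℂ))) 0 :=
      ((ContinuousLinearMap.inr ℂ ℂ (ℂ × (Fin N → ℂ))).comp
          (ContinuousLinearMap.inr ℂ ℂ (Fin N → ℂ))).hasFDerivAt
    have hd : HasFDerivAt F (fderiv ℂ F 0) ((fun y : Fin N → ℂ =>
      ((0, 0, y) : ℂ × ℂ × (Fin N → ℂ))) 0) := hF.differentiableAt.hasFDerivAt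
    have := (hd.comp (0 : Fin N → ℂ) hl).fderiv
    have h5 := congrArg (fun T : (Fin N → ℂ) →L[ℂ] (Fin N → ℂ) => T (Pi.single j 1)) this
    exact h5
  rw [h1, h3, div_one, partialDeriv, h2 _ (by simp), jacobian, LinearMap.toMatrix'_apply]
  simp only [ContinuousLinearMap.coe_coe]
  rw [h4]
  rfl

lemma exists_inverse_jacobian {N : ℕ} {F : ℂ × ℂ × (Fin N → ℂ) → Fin N → ℂ}
    (hDF : (fderiv ℂ (fun y : Fin N → ℂ => F (0, 0, y)) 0).IsInvertible) :
    ∃ B : Matrix (Fin N) (Fin N) ℂ, B * jacobian F = 1 ∧ jacobian F * B = 1 := by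
  obtain ⟨e, he⟩ := hDF
  refine ⟨LinearMap.toMatrix' (e.symm.toContinuousLinearMap : (Fin N → ℂ) →ₗ[ℂ] Fin N → ℂ), ?_, ?_⟩
  · rw [jacobian, ← he, ← LinearMap.toMatrix'_comp, ← LinearMap.toMatrix'_id]
    congr 1
    ext1 x
    ext
    simp
  · rw [jacobian, ← he, ← LinearMap.toMatrix'_comp, ← LinearMap.toMatrix'_id]
    congr 1
    ext1 x
    ext
    simp

/-! ### The fixed-point map: formal existence and uniqueness -/

/-- The map `y ↦ B (ε ^ α d_{q,x} y - g (x, ε, y))`. -/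
def picard {N : ℕ} (q : ℂ) (α : ℕ) (B : Matrix (Fin N) (Fin N) ℂ)
    (g : Fin N → MvPowerSeries (Fin 2 ⊕ Fin N) ℂ) (y : Fin N → FormalSeries) (i : Fin N) :
    FormalSeries :=
  ∑ j, B i j • ((X 1 : FormalSeries) ^ α * qDeriv q (y j) - subst (substPoint y) (g j))

section Formal

variable {N : ℕ} {q : ℂ} {α : ℕ} {B : Matrix (Fin N) (Fin N) ℂ}
  {g : Fin N → MvPowerSeries (Fin 2 ⊕ Fin N) ℂ}

lemma vanishesBelow_picard (hα : 0 < α) (hg0 : ∀ i, coeff 0 (g i) = 0) {y : Fin N → FormalSeries}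
    (hy : ∀ i, VanishesBelow 1 (y i)) (i : Fin N) : VanishesBelow 1 (picard q α B g y i) :=
  VanishesBelow.sum fun j _ => VanishesBelow.smul _
    ((((hy j).X_pow_mul_qDeriv hα).mono (by omega)).sub (vanishesBelow_subst hy (hg0 j)))

lemma vanishesBelow_picard_sub (hα : 0 < α)
    (hg1 : ∀ i j, coeff (Finsupp.single (Sum.inr j) 1) (g i) = 0) {y z : Fin N → FormalSeries}
    (hy : ∀ i, VanishesBelow 1 (y i)) (hz : ∀ i, VanishesBelow 1 (z i)) {w : ℕ}
    (hyz : ∀ i, VanishesBelow w (y i - z i)) (i : Fin N) :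
    VanishesBelow (w + 1) (picard q α B g y i - picard q α B g z i) := by
  unfold picard
  rw [← Finset.sum_sub_distrib]
  refine VanishesBelow.sum fun j _ => ?_
  rw [← smul_sub]
  refine VanishesBelow.smul _ ?_
  rw [sub_sub_sub_comm, ← mul_sub, ← qDeriv_sub]
  exact ((hyz j).X_pow_mul_qDeriv hα).sub (vanishesBelow_subst_sub hy hz hyz (hg1 j))

lemma picard_fixedPoint_unique (hα : 0 < α)
    (hg1 : ∀ i j, coeff (Finsupp.single (Sum.inr j) 1) (g i) = 0) {y z : Fin N → FormalSeries}
    (hy : ∀ i, VanishesBelow 1 (y i)) (hz : ∀ i, VanishesBelow 1 (z i))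
    (hy' : picard q α B g y = y) (hz' : picard q α B g z = z) : y = z := by
  have h : ∀ w i, VanishesBelow w (y i - z i) := by
    intro w
    induction w with
    | zero => exact fun i => vanishesBelow_zero_left _
    | succ w ih =>
      intro i
      have := vanishesBelow_picard_sub (B := B) (q := q) hα hg1 hy hz ih i
      rwa [hy', hz'] at this
  funext i
  exact eq_of_forall_vanishesBelow_sub fun w => h w i

lemma exists_picard_fixedPoint (hα : 0 < α) (hg0 : ∀ i, coeff 0 (g i) = 0)
    (hg1 : ∀ i j, coeff (Finsupp.single (Sum.inr j) 1) (g i) = 0) :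
    ∃ y : Fin N → FormalSeries, (∀ i, VanishesBelow 1 (y i)) ∧ picard q α B g y = y ∧
      ∀ n i, VanishesBelow n (y i - (picard q α B g)^[n] 0 i) := by
  set Y : ℕ → Fin N → FormalSeries := fun n => (picard q α B g)^[n] 0 with hY
  have hYs : ∀ n, Y (n + 1) = picard q α B g (Y n) := fun n =>
    Function.iterate_succ_apply' _ _ _
  have hY1 : ∀ n i, VanishesBelow 1 (Y n i) := by
    intro n
    induction n with
    | zero => exact fun i => vanishesBelow_zero 1
    | succ n ih => rw [hYs]; exact vanishesBelow_picard hα hg0 ih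
  have hstep : ∀ n i, VanishesBelow n (Y (n + 1) i - Y n i) := by
    intro n
    induction n with
    | zero => exact fun i => vanishesBelow_zero_left _
    | succ n ih =>
      intro i
      rw [hYs (n + 1), hYs n]
      exact vanishesBelow_picard_sub hα hg1 (by rw [← hYs]; exact hY1 _) (hY1 n)
        (by rw [← hYs]; exact ih) i
  have hdiff : ∀ n k i, VanishesBelow n (Y (n + k) i - Y n i) := by
    intro n k
    induction k with
    | zero => intro i; simpa using vanishesBelow_zero n
    | succ k ih =>
      intro i
      have := ((hstep (n + k) i).mono (Nat.le_add_right n k)).add (ih i)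
      rwa [sub_add_sub_cancel] at this
  -- By `hdiff`, a coefficient of weighted order `v` no longer changes from iterate `v + 1` on.
  let y : Fin N → FormalSeries := fun i m => coeff m (Y (m 0 + 2 * m 1 + 1) i)
  have hyY : ∀ n i, VanishesBelow n (y i - Y n i) := by
    intro n i m hm
    have h1 : coeff m (y i) = coeff m (Y (m 0 + 2 * m 1 + 1) i) := rfl
    obtain ⟨k, rfl⟩ := Nat.exists_eq_add_of_le (Nat.succ_le_of_lt hm)
    have h2 := hdiff (m 0 + 2 * m 1 + 1) k i m (by omega)
    rw [map_sub, sub_eq_zero] at h2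
    rw [map_sub, h1, sub_eq_zero]
    exact h2.symm
  have hy1 : ∀ i, VanishesBelow 1 (y i) := fun i => by
    have := (hyY 1 i).add (hY1 1 i)
    rwa [sub_add_cancel] at this
  refine ⟨y, hy1, ?_, hyY⟩
  funext i
  refine eq_of_forall_vanishesBelow_sub fun w => ?_
  have h1 := vanishesBelow_picard_sub (B := B) (q := q) hα hg1 hy1 (hY1 w) (hyY w) i
  rw [← hYs] at h1
  have h2 := h1.sub (hyY (w + 1) i)
  rw [sub_sub_sub_cancel_right] at h2
  exact h2.mono (by omega)

/-- A Fatou argument: on a finite set of exponents `f` coincides with `f' n` for `n` large, and the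
norm is the supremum of its finite partial sums. -/
lemma wnorm_le_of_forall_vanishesBelow {W : (Fin 2 →₀ ℕ) → ENNReal} {f : FormalSeries}
    {f' : ℕ → FormalSeries} {R : ENNReal} (h : ∀ n, VanishesBelow n (f - f' n))
    (hR : ∀ n, wnorm W (f' n) ≤ R) : wnorm W f ≤ R := by
  unfold wnorm
  rw [ENNReal.tsum_eq_iSup_sum]
  refine iSup_le fun S => ?_
  set n := S.sup (fun m => m 0 + 2 * m 1) + 1
  refine le_trans ?_ ((ENNReal.sum_le_tsum S).trans (hR n))
  refine Finset.sum_le_sum fun m hm => ?_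
  have hlt : m 0 + 2 * m 1 < n :=
    Nat.lt_succ_of_le (Finset.le_sup (f := fun m : Fin 2 →₀ ℕ => m 0 + 2 * m 1) hm)
  have := h n m hlt
  rw [map_sub, sub_eq_zero] at this
  rw [this]

lemma wnorm_picard_le {W : (Fin 2 →₀ ℕ) → ENNReal} {y : Fin N → FormalSeries} {β D G : ENNReal}
    (hB : ∀ i j, ‖B i j‖ₑ ≤ β)
    (hD : ∀ j, wnorm W ((X 1 : FormalSeries) ^ α * qDeriv q (y j)) ≤ D)
    (hG : ∀ j, wnorm W (subst (substPoint y) (g j)) ≤ G) (i : Fin N) :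
    wnorm W (picard q α B g y i) ≤ N * β * (D + G) := by
  unfold picard
  refine (wnorm_sum_le _ _).trans ?_
  have : ∀ j ∈ (Finset.univ : Finset (Fin N)), wnorm W (B i j •
      ((X 1 : FormalSeries) ^ α * qDeriv q (y j) - subst (substPoint y) (g j))) ≤ β * (D + G) := by
    intro j _
    rw [wnorm_smul]
    gcongr
    · exact hB i j
    · exact (wnorm_sub_le _ _).trans (add_le_add (hD j) (hG j))
  refine (Finset.sum_le_card_nsmul _ _ _ this).trans (le_of_eq ?_)
  simp [mul_assoc]

end Formal

/-! ### Reduction of the equation to the fixed-point problem -/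

/-- The Taylor series of `F` without its linear part in `y`. -/
def nonlinearPart {N : ℕ} (F : ℂ × ℂ × (Fin N → ℂ) → Fin N → ℂ) (i : Fin N) :
    MvPowerSeries (Fin 2 ⊕ Fin N) ℂ :=
  taylorSeries F i - ∑ k, jacobian F i k • X (Sum.inr k)

section NonlinearPart

variable {N : ℕ} {F : ℂ × ℂ × (Fin N → ℂ) → Fin N → ℂ}

lemma coeff_nonlinearPart_of_ne (i : Fin N) {d : Fin 2 ⊕ Fin N →₀ ℕ}
    (hd : ∀ j, d ≠ Finsupp.single (Sum.inr j) 1) :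
    coeff d (nonlinearPart F i) = coeff d (taylorSeries F i) := by
  classical
  unfold nonlinearPart
  rw [map_sub, map_sum, Finset.sum_eq_zero, sub_zero]
  intro k _
  rw [coeff_smul, coeff_X, if_neg (hd k), mul_zero]

lemma coeff_single_inr_nonlinearPart (hF : AnalyticAt ℂ F 0) (i j : Fin N) :
    coeff (Finsupp.single (Sum.inr j) 1) (nonlinearPart F i) = 0 := by
  classical
  unfold nonlinearPart
  rw [map_sub, map_sum, coeff_single_inr_taylorSeries hF, Finset.sum_eq_single j]
  · rw [coeff_smul, coeff_X, if_pos rfl, mul_one, sub_self]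
  · intro k _ hk
    rw [coeff_smul, coeff_X, if_neg, mul_zero]
    intro h
    have := Finsupp.single_left_injective one_ne_zero h
    exact hk (Sum.inr.inj this).symm
  · simp

lemma coeff_zero_nonlinearPart (hF0 : F 0 = 0) (i : Fin N) : coeff 0 (nonlinearPart F i) = 0 := by
  rw [coeff_nonlinearPart_of_ne, coeff_zero_taylorSeries hF0]
  intro j h
  have := DFunLike.congr_fun h (Sum.inr j)
  simp at this

lemma exists_norm_coeff_nonlinearPart_le (hF : AnalyticAt ℂ F 0) : ∃ C K : ℝ≥0, ∀ i d,
    ‖coeff d (nonlinearPart F i)‖ₑ ≤ (C : ENNReal) * Nat.multinomial Finset.univ d *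
      (K : ENNReal) ^ d.degree := by
  obtain ⟨C, K, h⟩ := exists_norm_coeff_taylorSeries_le hF
  refine ⟨C, K, fun i d => ?_⟩
  by_cases hd : ∀ j, d ≠ Finsupp.single (Sum.inr j) 1
  · rw [coeff_nonlinearPart_of_ne i hd]
    exact h i d
  · push Not at hd
    obtain ⟨j, rfl⟩ := hd
    rw [coeff_single_inr_nonlinearPart hF]
    simp

lemma formalComp_eq {y : Fin N → FormalSeries} (hy : ∀ i, VanishesBelow 1 (y i)) (i : Fin N) :
    formalComp F y i = subst (substPoint y) (nonlinearPart F i) + ∑ k, jacobian F i k • y k := by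
  have h := hasSubst_substPoint hy
  have h1 : taylorSeries F i =
      nonlinearPart F i + ∑ k, jacobian F i k • X (Sum.inr k) := by
    simp [nonlinearPart]
  unfold formalComp
  rw [h1, subst_add h]
  congr 1
  rw [← substAlgHom_apply h, map_sum]
  refine Finset.sum_congr rfl fun k _ => ?_
  rw [substAlgHom_apply h, subst_smul h, subst_X h]
  rfl

lemma isFormalSolution_iff {q : ℂ} {α : ℕ} {B : Matrix (Fin N) (Fin N) ℂ}
    (hBA : B * jacobian F = 1) (hAB : jacobian F * B = 1) (y : Fin N → FormalSeries) :
    IsFormalSolution q α F y ↔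
      (∀ i, VanishesBelow 1 (y i)) ∧ picard q α B (nonlinearPart F) y = y := by
  have hmul : ∀ (P Q : Matrix (Fin N) (Fin N) ℂ) (v : Fin N → FormalSeries) (i : Fin N),
      ∑ j, P i j • ∑ k, Q j k • v k = ∑ k, (P * Q) i k • v k := by
    intro P Q v i
    simp_rw [Finset.smul_sum, smul_smul, Matrix.mul_apply, Finset.sum_smul]
    exact Finset.sum_comm
  have hone : ∀ (v : Fin N → FormalSeries) (i : Fin N),
      ∑ k, (1 : Matrix (Fin N) (Fin N) ℂ) i k • v k = v i := by
    intro v i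
    simp [Matrix.one_apply]
  unfold IsFormalSolution
  simp_rw [vanishesBelow_one_iff]
  refine and_congr_right fun hy => ?_
  have hy1 : ∀ i, VanishesBelow 1 (y i) := fun i => vanishesBelow_one_iff.2 (hy i)
  simp_rw [formalComp_eq hy1]
  constructor
  · intro h
    funext i
    unfold picard
    simp_rw [h, add_sub_cancel_left]
    rw [hmul, hBA, hone]
  · intro h i
    rw [← sub_eq_iff_eq_add', eq_comm]
    calc ∑ k, jacobian F i k • y k
        = ∑ k, jacobian F i k • picard q α B (nonlinearPart F) y k := by rw [h]
      _ = _ := by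
        unfold picard
        rw [hmul, hAB, hone]

end NonlinearPart

/-! ### An invariant ball for the weighted norm -/

/-- The order of choice matters: `R` makes the quadratic term at most `R / 4`, then `r` makes the
linear term at most `R / 4`, then `s` makes the derivative term, which carries `1 / r`, at most `R /
2`. -/
lemma exists_contraction_parameters {α : ℕ} (hα : 0 < α) (L C M κ : ℝ≥0) :
    ∃ R r s : ℝ≥0, 0 < R ∧ 0 < r ∧ 0 < s ∧ r ≤ R ∧ s ≤ r ∧ L * R ≤ 2⁻¹ ∧
      M * (κ * s ^ α / r * R + C * (L * r + 2 * (L * R) ^ 2)) ≤ R := by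
  set R : ℝ≥0 := (2 * L + 8 * M * C * L ^ 2 + 1)⁻¹ with hR
  have hR0 : 0 < R := by positivity
  have hR1 : (2 * L + 8 * M * C * L ^ 2 + 1) * R = 1 := mul_inv_cancel₀ (by positivity)
  set r : ℝ≥0 := R / (4 * M * C * L + 1) with hr
  have hr0 : 0 < r := by positivity
  have hr1 : (4 * M * C * L + 1) * r = R := mul_div_cancel₀ _ (by positivity)
  set t : ℝ≥0 := r / (2 * M * κ + 1) with ht
  have ht0 : 0 < t := by positivity
  have ht1 : (2 * M * κ + 1) * t = r := mul_div_cancel₀ _ (by positivity)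
  -- The cap at 1 gives `s ^ α ≤ s ≤ t` for `s = min 1 t`, whatever `α ≥ 1`.
  have hs0 : 0 < min 1 t := by positivity
  have hsα : (min 1 t) ^ α ≤ t := by
    refine (pow_le_pow_of_le_one zero_le (min_le_left 1 t) hα).trans ?_
    simp
  have h1 : M * κ * (min 1 t) ^ α ≤ 2⁻¹ * r := by
    calc M * κ * (min 1 t) ^ α ≤ M * κ * t := by gcongr
      _ = 2⁻¹ * (2 * M * κ * t) := by ring_nf
      _ ≤ 2⁻¹ * r := by
        gcongr
        rw [← ht1, add_mul]
        exact le_self_add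
  refine ⟨R, r, min 1 t, hR0, hr0, hs0, ?_, ?_, ?_, ?_⟩
  · rw [← hr1, add_mul, one_mul]; exact le_add_self
  · refine (min_le_right _ _).trans ?_
    rw [← ht1, add_mul, one_mul]; exact le_add_self
  · rw [← NNReal.coe_le_coe]
    have : ((2 * L + 8 * M * C * L ^ 2 + 1) * R : ℝ) = 1 := by exact_mod_cast hR1
    push_cast
    have h2 : (0 : ℝ) ≤ M * C * L ^ 2 * R := by positivity
    have h3 : (0 : ℝ) ≤ R := R.2
    linarith
  · have h4 : M * (κ * (min 1 t) ^ α / r * R) ≤ 2⁻¹ * R := by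
      calc M * (κ * (min 1 t) ^ α / r * R) = M * κ * (min 1 t) ^ α * (R / r) := by ring
        _ ≤ 2⁻¹ * r * (R / r) := by gcongr
        _ = 2⁻¹ * R := by field_simp
    have h5 : M * (C * (L * r)) ≤ 4⁻¹ * R := by
      rw [← NNReal.coe_le_coe]
      have : ((4 * M * C * L + 1) * r : ℝ) = R := by exact_mod_cast hr1
      push_cast
      have h3 : (0 : ℝ) ≤ r := r.2
      linarith
    have h6 : M * (C * (2 * (L * R) ^ 2)) ≤ 4⁻¹ * R := by
      rw [← NNReal.coe_le_coe]
      have : ((2 * L + 8 * M * C * L ^ 2 + 1) * R : ℝ) = 1 := by exact_mod_cast hR1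
      push_cast
      have h3 : (0 : ℝ) ≤ R := R.2
      have h7 : (0 : ℝ) ≤ L * R := by positivity
      have h8 : (8 * M * C * L ^ 2 * R : ℝ) ≤ 1 := by linarith
      nlinarith [mul_le_mul_of_nonneg_right h8 h3]
    rw [← NNReal.coe_le_coe] at h4 h5 h6 ⊢
    push_cast at h4 h5 h6 ⊢
    linarith

/-- For suitable parameters, the Picard iterates stay in a ball of the weighted norm. -/
lemma exists_forall_wnorm_iterate_picard_le {N : ℕ} {q : ℂ} (hq : 1 < ‖q‖) {α : ℕ} (hα : 0 < α)
    (B : Matrix (Fin N) (Fin N) ℂ) {g : Fin N → MvPowerSeries (Fin 2 ⊕ Fin N) ℂ}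
    (hg0 : ∀ i, coeff 0 (g i) = 0)
    (hg1 : ∀ i j, coeff (Finsupp.single (Sum.inr j) 1) (g i) = 0) {C K : ℝ≥0}
    (hg : ∀ i d, ‖coeff d (g i)‖ₑ ≤ (C : ENNReal) * Nat.multinomial Finset.univ d *
      (K : ENNReal) ^ d.degree) :
    ∃ R r s : ℝ≥0, 0 < R ∧ 0 < r ∧ 0 < s ∧ ∀ n i,
      wnorm (gevreyWeight ‖q‖₊ r s α) ((picard q α B g)^[n] 0 i) ≤ R := by
  have hQ : 1 < ‖q‖₊ := hq
  set β : ℝ≥0 := ∑ i, ∑ j, ‖B i j‖₊ with hβ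
  have hB : ∀ i j, ‖B i j‖ₑ ≤ (β : ENNReal) := by
    intro i j
    rw [enorm_eq_nnnorm, ENNReal.coe_le_coe]
    calc ‖B i j‖₊ ≤ ∑ j, ‖B i j‖₊ :=
          Finset.single_le_sum (f := fun j => ‖B i j‖₊) (fun _ _ => zero_le) (Finset.mem_univ j)
      _ ≤ β := Finset.single_le_sum (f := fun i => ∑ j, ‖B i j‖₊) (fun _ _ => zero_le)
          (Finset.mem_univ i)
  obtain ⟨R, r, s, hR, hr, hs, hrR, hsr, hLR, hbound⟩ :=
    exists_contraction_parameters hα (((N + 2 : ℕ) : ℝ≥0) * K) C (N * β) (2 / ‖q - 1‖₊)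
  refine ⟨R, r, s, hR, hr, hs, fun n => ?_⟩
  suffices h : (∀ i, VanishesBelow 1 ((picard q α B g)^[n] 0 i)) ∧
      ∀ i, wnorm (gevreyWeight ‖q‖₊ r s α) ((picard q α B g)^[n] 0 i) ≤ R from h.2
  induction n with
  | zero => exact ⟨fun i => vanishesBelow_zero 1, fun i => by simp [wnorm_zero]⟩
  | succ n ih =>
    rw [Function.iterate_succ_apply']
    refine ⟨vanishesBelow_picard hα hg0 ih.1, fun i => ?_⟩
    have hD : ∀ j, wnorm (gevreyWeight ‖q‖₊ r s α) ((X 1 : FormalSeries) ^ α *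
        qDeriv q ((picard q α B g)^[n] 0 j)) ≤
        ((2 / ‖q - 1‖₊ * s ^ α / r : ℝ≥0) : ENNReal) * (R : ENNReal) := fun j =>
      (wnorm_X_pow_mul_qDeriv_le hq hr s hα _).trans (mul_le_mul' le_rfl (ih.2 j))
    have hX : ∀ t : Fin 2, wnorm (gevreyWeight ‖q‖₊ r s α) (X t : FormalSeries) ≤ r := by
      intro t
      fin_cases t
      · exact (wnorm_X_zero _ _ _).le
      · exact (wnorm_X_one_le hQ r s).trans (by exact_mod_cast hsr)
    have hLR' : ((N + 2 : ℕ) : ENNReal) * K * R ≤ 2⁻¹ := by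
      have : (((((N + 2 : ℕ) : ℝ≥0) * K * R : ℝ≥0)) : ENNReal) ≤ ((2⁻¹ : ℝ≥0) : ENNReal) :=
        ENNReal.coe_le_coe.2 hLR
      rw [ENNReal.coe_inv two_ne_zero, ENNReal.coe_mul, ENNReal.coe_mul, ENNReal.coe_natCast] at this
      exact this
    have hG := fun j => wnorm_subst_le_of_coeff_le
      (isSubmultWeight_gevreyWeight hQ r s α) ih.1 (hg0 j) (hg1 j) (hg j) hX ih.2
      (by exact_mod_cast hrR) hLR'
    refine (wnorm_picard_le hB hD hG i).trans ?_
    exact_mod_cast ENNReal.coe_le_coe.2 hbound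

/-! ### From the norm bound to the coefficients of the powers of `ε` -/

lemma summable_and_tsum_le_of_wnorm_le {Q r s R : ℝ≥0} (hQ : 1 < Q) (hs : 0 < s) {α : ℕ}
    {f : FormalSeries} (hf : wnorm (gevreyWeight Q r s α) f ≤ R) (n : ℕ) :
    Summable (fun k => ‖coeff (expo k n) f‖₊ * (r / Q ^ (n / α)) ^ k) ∧
      ∑' k, ‖coeff (expo k n) f‖₊ * (r / Q ^ (n / α)) ^ k ≤
        R * Q ^ triangular (n / α) / s ^ n := by
  have hQ0 : 0 < Q := by positivity
  have hinj : Function.Injective fun k => expo k n := by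
    intro a b h
    have := DFunLike.congr_fun h 0
    simpa [expo] using this
  set c : ℝ≥0 := s ^ n / Q ^ triangular (n / α) with hc
  have hc0 : 0 < c := by positivity
  have h1 : ∑' k, ((‖coeff (expo k n) f‖₊ * (r / Q ^ (n / α)) ^ k * c : ℝ≥0) : ENNReal) ≤ R := by
    refine le_trans (le_of_eq ?_) ((ENNReal.tsum_comp_le_tsum_of_injective hinj _).trans hf)
    refine tsum_congr fun k => ?_
    have e0 : expo k n 0 = k := by simp [expo]
    have e1 : expo k n 1 = n := by simp [expo]
    rw [gevreyWeight, e0, e1, enorm_eq_nnnorm, ← ENNReal.coe_mul, hc]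
    congr 1
    ring
  have h2 : Summable fun k => ‖coeff (expo k n) f‖₊ * (r / Q ^ (n / α)) ^ k * c :=
    ENNReal.tsum_coe_ne_top_iff_summable.1 (h1.trans_lt ENNReal.coe_lt_top).ne
  rw [← ENNReal.coe_tsum h2, ENNReal.coe_le_coe, NNReal.tsum_mul_right] at h1
  refine ⟨(summable_mul_right_iff hc0.ne').1 h2, ?_⟩
  rw [← le_div_iff₀ hc0] at h1
  refine h1.trans (le_of_eq ?_)
  rw [hc]
  field_simp

/-- With `l = ⌊n / α⌋` the exponent is `l ^ 2 / 2 + l / 2`. The first term gives the Gevrey factor;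
the second is at most `n` and goes into the geometric constant. -/
lemma pow_triangular_le {Q : ℝ} (hQ : 1 < Q) {α : ℕ} (hα : 0 < α) (n : ℕ) :
    Q ^ triangular (n / α) ≤ Q ^ n * Q ^ ((n : ℝ) ^ 2 / (2 * (α : ℝ) ^ 2)) := by
  have hQ0 : 0 < Q := by positivity
  rw [← Real.rpow_natCast, ← Real.rpow_natCast, ← Real.rpow_add hQ0]
  refine Real.rpow_le_rpow_of_exponent_le hQ.le ?_
  have h1 : (2 * triangular (n / α) : ℝ) = (n / α : ℕ) * ((n / α : ℕ) + 1) := by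
    exact_mod_cast two_mul_triangular (n / α)
  have h2 : ((n / α : ℕ) : ℝ) ≤ n := by exact_mod_cast Nat.div_le_self n α
  have h3 : ((n / α : ℕ) : ℝ) ≤ (n : ℝ) / α := Nat.cast_div_le
  have h4 : ((n / α : ℕ) : ℝ) ^ 2 ≤ ((n : ℝ) / α) ^ 2 := by gcongr
  have h5 : (n : ℝ) ^ 2 / (2 * (α : ℝ) ^ 2) = ((n : ℝ) / α) ^ 2 / 2 := by
    field_simp
  rw [h5]
  have h6 : (0 : ℝ) ≤ n := by positivity
  nlinarith

end QDiff
end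

theorem theorem2 (q : ℂ) (hq : 1 < ‖q‖) (N α : ℕ) (hα : 0 < α)
    (F : ℂ × ℂ × (Fin N → ℂ) → Fin N → ℂ)
    (hF : AnalyticAt ℂ F (0, 0, 0))
    (hF0 : F (0, 0, 0) = 0)
    (hDF : (fderiv ℂ (fun y : Fin N → ℂ => F (0, 0, y)) 0).IsInvertible) :
    ∃ y : Fin N → QDiff.FormalSeries,
      QDiff.IsFormalSolution q α F y ∧
      (∀ z : Fin N → QDiff.FormalSeries, QDiff.IsFormalSolution q α F z → z = y) ∧
      ∃ r : ℝ, 0 < r ∧ ∃ u : ℕ → ℂ → Fin N → ℂ,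
        (∀ n : ℕ, QDiff.IsSumOfCoeff y n (u n) (closedBall 0 (r / ‖q‖ ^ (n / α)))) ∧
        (∀ n : ℕ, QDiff.BoundedHolomorphicOn (u n) (ball 0 (r / ‖q‖ ^ (n / α)))) ∧
        ∃ C A : ℝ, 0 < C ∧ 0 < A ∧
          ∀ n : ℕ, ∀ x ∈ closedBall (0 : ℂ) (r / ‖q‖ ^ (n / α)),
            ‖u n x‖ ≤ C * A ^ n * ‖q‖ ^ ((n : ℝ) ^ 2 / (2 * (α : ℝ) ^ 2)) := by
  open QDiff in
  have hF' : AnalyticAt ℂ F 0 := hF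
  have hg0 := coeff_zero_nonlinearPart (F := F) hF0
  have hg1 := coeff_single_inr_nonlinearPart hF'
  obtain ⟨B, hBA, hAB⟩ := exists_inverse_jacobian hDF
  obtain ⟨C, K, hg⟩ := exists_norm_coeff_nonlinearPart_le hF'
  obtain ⟨y, hy1, hfix, hlim⟩ := exists_picard_fixedPoint (q := q) (B := B) hα hg0 hg1
  obtain ⟨R, r, s, hR, hr, hs, hiter⟩ := exists_forall_wnorm_iterate_picard_le hq hα B hg0 hg1 hg
  have hsum := fun (i : Fin N) (n : ℕ) => summable_and_tsum_le_of_wnorm_le (show 1 < ‖q‖₊ from hq) hs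
    (wnorm_le_of_forall_vanishesBelow (fun n => hlim n i) fun n => hiter n i) n
  have hsummable : ∀ i n, Summable fun k =>
      ‖coeff (expo k n) (y i)‖ * ((r : ℝ) / ‖q‖ ^ (n / α)) ^ k := fun i n => by
    simpa using NNReal.summable_coe.2 (hsum i n).1
  have htsum : ∀ i n, ∑' k, ‖coeff (expo k n) (y i)‖ * ((r : ℝ) / ‖q‖ ^ (n / α)) ^ k ≤
      R * ‖q‖ ^ triangular (n / α) / (s : ℝ) ^ n := fun i n => by
    simpa [NNReal.coe_tsum] using NNReal.coe_le_coe.2 (hsum i n).2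
  have hterm : ∀ i n k, ∀ x ∈ closedBall (0 : ℂ) ((r : ℝ) / ‖q‖ ^ (n / α)),
      ‖coeff (expo k n) (y i) * x ^ k‖ ≤
        ‖coeff (expo k n) (y i)‖ * ((r : ℝ) / ‖q‖ ^ (n / α)) ^ k := by
    intro i n k x hx
    rw [mem_closedBall_zero_iff] at hx
    rw [norm_mul, norm_pow]
    gcongr
  have hbound : ∀ n, ∀ x ∈ closedBall (0 : ℂ) ((r : ℝ) / ‖q‖ ^ (n / α)),
      ‖fun i => ∑' k, coeff (expo k n) (y i) * x ^ k‖ ≤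
        R * ‖q‖ ^ triangular (n / α) / (s : ℝ) ^ n := by
    intro n x hx
    rw [pi_norm_le_iff_of_nonneg (by positivity)]
    exact fun i => (tsum_of_norm_bounded (hsummable i n).hasSum
      fun k => hterm i n k x hx).trans (htsum i n)
  -- In `A = ‖q‖ / s`, the factor `‖q‖ ^ n` comes from `pow_triangular_le` and `s ^ (-n)` from the
  -- weight of `ε ^ n`.
  refine ⟨y, (isFormalSolution_iff hBA hAB y).2 ⟨hy1, hfix⟩, fun z hz => ?_, r, hr,
    fun n x i => ∑' k, coeff (expo k n) (y i) * x ^ k, fun n x hx i => ?_, fun n => ⟨?_, ?_⟩,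
    R, ‖q‖ / s, hR, by positivity, fun n x hx => ?_⟩
  · obtain ⟨hz1, hz2⟩ := (isFormalSolution_iff hBA hAB z).1 hz
    exact picard_fixedPoint_unique hα hg1 hz1 hy1 hz2 hfix
  · exact (Summable.of_norm_bounded (hsummable i n) fun k => hterm i n k x hx).hasSum
  · rw [differentiableOn_pi]
    intro i
    exact Complex.differentiableOn_tsum_of_summable_norm (hsummable i n) (fun k => by fun_prop)
      isOpen_ball fun k x hx => hterm i n k x (ball_subset_closedBall hx)
  · exact ⟨_, fun x hx => hbound n x (ball_subset_closedBall hx)⟩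
  · refine (hbound n x hx).trans ?_
    rw [div_pow]
    calc R * ‖q‖ ^ triangular (n / α) / (s : ℝ) ^ n
        ≤ R * (‖q‖ ^ n * ‖q‖ ^ ((n : ℝ) ^ 2 / (2 * (α : ℝ) ^ 2))) / (s : ℝ) ^ n := by
          gcongr
          exact pow_triangular_le hq hα n
      _ = _ := by ring
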